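/- **Setting.** Let $\mathcal G$ be a connected undirected graph (without self-loops) with vertex set $\{1,\dots,N\}$ (the agents), let $\mathcal N_i$ be the set of neighbours of $i$ and $d_i=|\mathcal N_i|$. Let $f_1,\dots,f_N:\mathbb R^n\to\mathbb R$ be differentiable, each gradient $\nabla f_i$ being $L$-Lipschitz, and let $f=\sum_{i=1}^N f_i$ be $\mu$-strongly convex, $\mu>0$ (the individual $f_i$ need not be convex). **Algorithm.** Given parameters $\rho,\alpha,\gamma,\delta$ and arbitrary initial values $x_i^0\in\mathbb R^n$ and $z_{ij}^0\in\mathbb R^{2n}$ ($j\in\mathcal N_i$), every agent $i$ computes, for $t=0,1,2,\dots$, $$\begin{bmatrix}y_i^t\\ s_i^t\end{bmatrix}=\frac1{1+\rho d_i}\left(\begin{bmatrix}x_i^t\\ \nabla f_i(x_i^t)\end{bmatrix}+\sum_{j\in\mathcal N_i}z_{ij}^t\right),\qquad x_i^{t+1}=x_i^t+\gamma(y_i^t-x_i^t)-\gamma\delta s_i^t,$$ $$z_{ij}^{t+1}=(1-\alpha)z_{ij}^t+\alpha\, m_{ji}^t\quad(j\in\mathcal N_i),\qquad\text{where } m_{ji}^t=-z_{ji}^t+2\rho\begin{bmatrix}y_j^t\\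 s_j^t\end{bmatrix}$$ is the message that agent $i$ receives from its neighbour $j$. **Theorem.** The function $f$ has a unique minimizer $x^\star$. For every $\rho>0$ and $\alpha\in(0,1)$ there is $\bar\gamma>0$ such that, for every $\delta\in\bigl(0,\tfrac{2\mu}{NL^2}\bigr)$ and $\gamma\in(0,\bar\gamma)$, the algorithm converges linearly to $x^\star$: there are a constant $\kappa>0$ (independent of $\gamma$ and of the initialization) and a constant $c_2>0$ (independent of the initialization) such that, for every initialization, every agent $i$ and every $t\in\mathbb N$, $$\|x_i^t-x^\star\|\le c_1\exp(-c_2t),\qquad c_1=\kappa\Bigl(1+\sum_{j=1}^N\|x_j^0\|+\sum_{i=1}^N\sum_{j\in\mathcal N_i}\|z_{ij}^0\|\Bigr).$$ Here $\bar\gamma$ depends only on the problem data, $\rho$ and $\alpha$; $\kappa$ depends only on the problem data, $\rho$, $\alpha$ and $\delta$; and $c_2$ depends only on these and $\gamma$. -/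

import Mathlib

namespace ADMMTracking

/-- The decision space `ℝⁿ`, with its Euclidean norm. -/
abbrev Vec (n : ℕ) := EuclideanSpace ℝ (Fin n)

/-- The variables of all the agents at one iteration. An edge variable `z_ij ∈ ℝ²ⁿ` is attached to
each ordered pair of neighbours `(i, j)`, that is, to each dart of the graph with `fst = i` and
`snd = j`; its two `n`-dimensional blocks are `(z d).1` (tracking the mean of the estimates) and
`(z d).2` (tracking the mean of the gradients). -/
structure State {N : ℕ} (G : SimpleGraph (Fin N)) (n : ℕ) where
  /-- the solution estimate `x_i` of each agent -/
  x : Fin N → Vec n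
  /-- the auxiliary variable `z_ij`, owned by agent `i = d.fst`, for each neighbour `j = d.snd` -/
  z : G.Dart → Vec n × Vec n

variable {N n : ℕ} (G : SimpleGraph (Fin N)) [DecidableRel G.Adj] (f : Fin N → Vec n → ℝ)

/-- `[y_i; s_i] = (1 + ρ d_i)⁻¹ ([x_i; ∇f_i(x_i)] + ∑_{j ∈ 𝒩_i} z_ij)`. -/
noncomputable def proxy (ρ : ℝ) (S : State G n) (i : Fin N) : Vec n × Vec n :=
  (1 / (1 + ρ * (G.degree i : ℝ))) •
    ((S.x i, gradient (f i) (S.x i)) + ∑ d : G.Dart with d.fst = i, S.z d)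

/-- The message `m_ij = -z_ij + 2ρ [y_i; s_i]` that agent `i = d.fst` transmits to `j = d.snd`. -/
noncomputable def message (ρ : ℝ) (S : State G n) (d : G.Dart) : Vec n × Vec n :=
  -S.z d + (2 * ρ) • proxy G f ρ S d.fst

/-- One iteration of the algorithm, at all agents:
`x_i⁺ = x_i + γ (y_i - x_i) - γ δ s_i` and `z_ij⁺ = (1 - α) z_ij + α m_ji`. -/
noncomputable def step (ρ α γ δ : ℝ) (S : State G n) : State G n where
  x i := S.x i + γ • ((proxy G f ρ S i).1 - S.x i) - (γ * δ) • (proxy G f ρ S i).2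
  z d := (1 - α) • S.z d + α • message G f ρ S d.symm

/-- The state after `t` iterations, from the initialization `S₀`. -/
noncomputable def iterate (ρ α γ δ : ℝ) (S₀ : State G n) (t : ℕ) : State G n :=
  (step G f ρ α γ δ)^[t] S₀

end ADMMTracking

/-! ### Averaged nonexpansive operators in finite dimension. -/

section Averaged

variable {H : Type*} [NormedAddCommGroup H] [InnerProductSpace ℝ H]

/-! The algorithm is a slow-fast cascade. The edge variables form a fast linear system, driven by
the estimates in one block and the local gradients in the other. The estimates move slowly, with
step `γ`, by consensus plus gradient descent on `f`, perturbed by the tracking error.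

Fast part: for a frozen input the edge update averages the identity with a nonexpansive affine map.
By strict convexity of the norm and compactness it contracts on the orthogonal complement of the
fixed vectors of the linear part. Fixed vectors do not affect the local estimates, inputs lie in the
complement, and the equilibrium outputs the exact mean. Hence `exists_tracking_error`: geometric
decay, up to the variation of the input.

Slow part: the mean takes a gradient step for the strongly convex sum, so its distance to the
minimizer contracts at rate of order `γδ`, and the consensus error contracts at rate `γ`. Convexity
of the individual `f i` is not needed. The input variation is of order `γ`, and its dependence on
the optimality error is of order `γδ`.

`exists_error_recursion` collects the three coupled inequalities. `exists_weighted_contraction`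
weights them into one Lyapunov function that contracts for all small `γ`, uniformly in the allowed
`δ`. -/

/-- The fixed subspace of a linear operator. -/
def fixedSubspace (M : H →L[ℝ] H) : Submodule ℝ H :=
  LinearMap.ker ((ContinuousLinearMap.id ℝ H - M : H →L[ℝ] H) : H →ₗ[ℝ] H)

theorem mem_fixedSubspace {M : H →L[ℝ] H} {w : H} : w ∈ fixedSubspace M ↔ M w = w := by
  simp [fixedSubspace, sub_eq_zero, eq_comm (a := w)]

variable [FiniteDimensional ℝ H]

/-- A fixed vector of a nonexpansive operator is also fixed by the adjoint. -/
theorem inner_apply_fixed {M : H →L[ℝ] H} (hM : ∀ x, ‖M x‖ ≤ ‖x‖) {v : H} (hv : M v = v) (w : H) :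
    inner ℝ v (M w) = inner ℝ v w := by
  have : CompleteSpace H := FiniteDimensional.complete ℝ H
  set A := ContinuousLinearMap.adjoint M
  have hA : ‖A v‖ ≤ ‖v‖ := by
    have h1 : ‖A‖ ≤ 1 := by
      rw [LinearIsometryEquiv.norm_map]
      exact M.opNorm_le_bound zero_le_one (by simpa using hM)
    calc ‖A v‖ ≤ ‖A‖ * ‖v‖ := A.le_opNorm v
      _ ≤ 1 * ‖v‖ := by gcongr
      _ = ‖v‖ := one_mul _
  have hfix : A v = v := by
    -- Since `⟪A v, v⟫ = ⟪v, M v⟫ = ‖v‖ ^ 2` and `‖A v‖ ≤ ‖v‖`, this square is at most zero.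
    have h2 : ‖A v - v‖ ^ 2 = ‖A v‖ ^ 2 - 2 * inner ℝ (A v) v + ‖v‖ ^ 2 := norm_sub_sq_real _ _
    rw [ContinuousLinearMap.adjoint_inner_left, hv, real_inner_self_eq_norm_sq] at h2
    have h3 : ‖A v - v‖ = 0 := by
      have := norm_nonneg (A v)
      nlinarith [norm_nonneg (A v - v), norm_nonneg v]
    exact sub_eq_zero.1 (norm_eq_zero.1 h3)
  rw [← ContinuousLinearMap.adjoint_inner_left]
  exact congrArg (fun x => inner ℝ x w) hfix

theorem apply_mem_orthogonal_fixed {M : H →L[ℝ] H} (hM : ∀ x, ‖M x‖ ≤ ‖x‖) {w : H}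
    (hw : w ∈ (fixedSubspace M)ᗮ) : M w ∈ (fixedSubspace M)ᗮ := by
  rw [Submodule.mem_orthogonal] at hw ⊢
  intro v hv
  rw [inner_apply_fixed hM (mem_fixedSubspace.1 hv), hw v hv]

/-- Both the fixed subspace and its complement are invariant under `M`, so the projection commutes
with `M`. -/
theorem starProjection_orthogonal_fixed_apply {M : H →L[ℝ] H} (hM : ∀ x, ‖M x‖ ≤ ‖x‖) (z : H) :
    (fixedSubspace M)ᗮ.starProjection (M z) = M ((fixedSubspace M)ᗮ.starProjection z) := by
  apply Submodule.eq_starProjection_of_mem_orthogonal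
  · exact apply_mem_orthogonal_fixed hM (Submodule.starProjection_apply_mem _ _)
  · have h1 := Submodule.sub_starProjection_mem_orthogonal (K := (fixedSubspace M)ᗮ) z
    rw [Submodule.orthogonal_orthogonal] at h1 ⊢
    rw [← map_sub, mem_fixedSubspace.1 h1]
    exact h1

/-- Strict convexity of the norm makes the averaged operator strictly shrink every non-fixed vector.
The unit sphere of the complement is compact and contains no fixed vector, so the largest ratio is
attained and is below one. -/
theorem exists_averaged_contraction {M : H →L[ℝ] H} (hM : ∀ x, ‖M x‖ ≤ ‖x‖) {α : ℝ}
    (hα : α ∈ Set.Ioo (0 : ℝ) 1) :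
    ∃ η ∈ Set.Ioc (0 : ℝ) 1, ∀ w ∈ (fixedSubspace M)ᗮ,
      ‖(1 - α) • w + α • M w‖ ≤ (1 - η) * ‖w‖ := by
  have hlt : ∀ w, M w ≠ w → ‖(1 - α) • w + α • M w‖ < ‖w‖ := fun w hw =>
    norm_combo_lt_of_ne le_rfl (hM w) hw.symm (by linarith [hα.2]) hα.1 (by ring)
  set K : Set H := Metric.sphere 0 1 ∩ (fixedSubspace M)ᗮ
  have hK : IsCompact K :=
    (isCompact_sphere 0 1).inter_right (Submodule.closed_of_finiteDimensional _)
  by_cases hne : K.Nonempty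
  · obtain ⟨w₀, ⟨hw₀, hw₀'⟩, hmax⟩ := hK.exists_isMaxOn hne
      (f := fun w => ‖(1 - α) • w + α • M w‖) (by fun_prop)
    have hn : ‖w₀‖ = 1 := by simpa using hw₀
    have hfix : M w₀ ≠ w₀ := by
      intro h
      have h0 := hw₀' w₀ (mem_fixedSubspace.2 h)
      rw [real_inner_self_eq_norm_sq, hn] at h0
      norm_num at h0
    have h1 := hlt w₀ hfix
    rw [hn] at h1
    refine ⟨1 - ‖(1 - α) • w₀ + α • M w₀‖, ⟨by linarith, by linarith [norm_nonneg ((1 - α) • w₀ + α • M w₀)]⟩, ?_⟩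
    intro w hw
    by_cases hw0 : w = 0
    · simp [hw0]
    have hwn : 0 < ‖w‖ := norm_pos_iff.2 hw0
    have hmem : ‖w‖⁻¹ • w ∈ K := by
      refine ⟨?_, Submodule.smul_mem _ _ hw⟩
      simp [norm_smul, hwn.ne']
    have h2 : ‖(1 - α) • (‖w‖⁻¹ • w) + α • M (‖w‖⁻¹ • w)‖ ≤ ‖(1 - α) • w₀ + α • M w₀‖ := hmax hmem
    rw [map_smul, smul_comm _ ‖w‖⁻¹ w, smul_comm _ ‖w‖⁻¹ (M w), ← smul_add, norm_smul,
      norm_inv, norm_norm, inv_mul_le_iff₀ hwn] at h2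
    linarith
  · refine ⟨1, ⟨one_pos, le_rfl⟩, fun w hw => ?_⟩
    have hw0 : w = 0 := by
      by_contra hw0
      have hwn : 0 < ‖w‖ := norm_pos_iff.2 hw0
      exact hne ⟨‖w‖⁻¹ • w, by simp [norm_smul, hwn.ne'], Submodule.smul_mem _ _ hw⟩
    simp [hw0]

/-- `1 - M` is invertible on the orthogonal complement of its kernel. -/
theorem exists_inverse_on_orthogonal_fixed {M : H →L[ℝ] H} (hM : ∀ x, ‖M x‖ ≤ ‖x‖) :
    ∃ R : H →L[ℝ] H, ∀ b ∈ (fixedSubspace M)ᗮ, R b ∈ (fixedSubspace M)ᗮ ∧ R b = M (R b) + b := by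
  set P := (fixedSubspace M).starProjection
  -- The range of `1 - M` is orthogonal to its kernel, so adding the projection onto the kernel
  -- gives an injective, hence invertible, operator that agrees with `1 - M` on the complement.
  set A : H →L[ℝ] H := ContinuousLinearMap.id ℝ H - M + P
  have horth : ∀ x, x - M x ∈ (fixedSubspace M)ᗮ := by
    intro x
    rw [Submodule.mem_orthogonal]
    intro v hv
    rw [inner_sub_right, inner_apply_fixed hM (mem_fixedSubspace.1 hv), sub_self]
  have hA : ∀ x, A x ∈ (fixedSubspace M)ᗮ → x ∈ (fixedSubspace M)ᗮ ∧ A x = x - M x := by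
    intro x hx
    have h1 : P x ∈ (fixedSubspace M)ᗮ := by
      have : P x = A x - (x - M x) := by simp [A]
      rw [this]
      exact Submodule.sub_mem _ hx (horth x)
    have h2 : P x = 0 := by
      have h3 := h1 (P x) (Submodule.starProjection_apply_mem _ _)
      exact inner_self_eq_zero.1 h3
    refine ⟨(Submodule.starProjection_apply_eq_zero_iff _).1 h2, by simp [A, h2]⟩
  have hinj : Function.Injective (A : H →ₗ[ℝ] H) := by
    rw [← LinearMap.ker_eq_bot, LinearMap.ker_eq_bot']
    intro x hx
    have hx' : A x = 0 := hx
    obtain ⟨h1, h2⟩ := hA x (by rw [hx']; exact Submodule.zero_mem _)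
    rw [hx', eq_comm, sub_eq_zero, eq_comm] at h2
    exact inner_self_eq_zero.1 (h1 x (mem_fixedSubspace.2 h2))
  let e := LinearEquiv.ofInjectiveEndo (A : H →ₗ[ℝ] H) hinj
  refine ⟨LinearMap.toContinuousLinearMap (e.symm : H →ₗ[ℝ] H), fun b hb => ?_⟩
  have he : A (e.symm b) = b := e.apply_symm_apply b
  obtain ⟨h1, h2⟩ := hA (e.symm b) (by rw [he]; exact hb)
  rw [he] at h2
  exact ⟨h1, sub_eq_iff_eq_add'.1 h2.symm⟩

end Averaged

/-! ### Averaging over the graph through edge variables. -/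

namespace ADMMTracking

section Tracker

variable {N : ℕ} (G : SimpleGraph (Fin N)) [DecidableRel G.Adj]
variable {E : Type*} [NormedAddCommGroup E] [InnerProductSpace ℝ E]

/-- The local estimate of the mean of `u`, computed from one block of the edge variables. -/
noncomputable def mixed (ρ : ℝ) (u : Fin N → E) (z : G.Dart → E) (i : Fin N) : E :=
  (1 / (1 + ρ * (G.degree i : ℝ))) • (u i + ∑ d : G.Dart with d.fst = i, z d)

/-- The update of one block of the edge variables, with input `u`. -/
noncomputable def edgeStep (ρ α : ℝ) (u : Fin N → E) (z : G.Dart → E) (d : G.Dart) : E :=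
  (1 - α) • z d + α • (-z d.symm + (2 * ρ) • mixed G ρ u z d.snd)

variable {G}

theorem mixed_add (ρ : ℝ) (u u' : Fin N → E) (z z' : G.Dart → E) (i : Fin N) :
    mixed G ρ (u + u') (z + z') i = mixed G ρ u z i + mixed G ρ u' z' i := by
  simp only [mixed, Pi.add_apply, Finset.sum_add_distrib, ← smul_add]
  congr 1
  abel

theorem mixed_smul (ρ c : ℝ) (u : Fin N → E) (z : G.Dart → E) (i : Fin N) :
    mixed G ρ (c • u) (c • z) i = c • mixed G ρ u z i := by
  simp only [mixed, Pi.smul_apply, ← Finset.smul_sum, ← smul_add]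
  rw [smul_comm]

theorem one_add_mul_degree_pos {ρ : ℝ} (hρ : 0 < ρ) (i : Fin N) :
    0 < 1 + ρ * (G.degree i : ℝ) := by positivity

theorem smul_mixed {ρ : ℝ} (hρ : 0 < ρ) (u : Fin N → E) (z : G.Dart → E) (i : Fin N) :
    (1 + ρ * (G.degree i : ℝ)) • mixed G ρ u z i = u i + ∑ d : G.Dart with d.fst = i, z d := by
  rw [mixed, smul_smul, mul_one_div_cancel (one_add_mul_degree_pos hρ i).ne', one_smul]

theorem sum_dart_fst {F : Type*} [AddCommMonoid F] (g : G.Dart → F) :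
    ∑ i, ∑ d : G.Dart with d.fst = i, g d = ∑ d, g d :=
  Finset.sum_fiberwise _ _ _

theorem sum_dart_symm {F : Type*} [AddCommMonoid F] (g : G.Dart → F) :
    ∑ d : G.Dart, g d.symm = ∑ d, g d :=
  Equiv.sum_comp (SimpleGraph.Dart.symm_involutive.toPerm _) g

theorem sum_dart_of_fst (g : Fin N → E) :
    ∑ d : G.Dart, g d.fst = ∑ i, (G.degree i : ℝ) • g i := by
  rw [← sum_dart_fst]
  refine Finset.sum_congr rfl fun i _ => ?_
  rw [Finset.sum_congr rfl (g := fun _ => g i) (by simp +contextual), Finset.sum_const,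
    G.dart_fst_fiber_card_eq_degree, Nat.cast_smul_eq_nsmul]

/-- A fixed point of the edge dynamics yields the exact mean. -/
theorem mixed_eq_mean (hG : G.Connected) {ρ : ℝ} (hρ : 0 < ρ) {u : Fin N → E} {z : G.Dart → E}
    (hz : ∀ d, z d = -z d.symm + (2 * ρ) • mixed G ρ u z d.snd) (i : Fin N) :
    mixed G ρ u z i = (N : ℝ)⁻¹ • ∑ j, u j := by
  -- The sum `z d + z d.symm` is symmetric under reversal and equals `2ρ` times the local estimate
  -- at either endpoint.
  have hadj : ∀ i j, G.Adj i j → mixed G ρ u z i = mixed G ρ u z j := by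
    intro i j hij
    have h1 := hz ⟨(i, j), hij⟩
    have h2 := hz (SimpleGraph.Dart.symm ⟨(i, j), hij⟩)
    rw [SimpleGraph.Dart.symm_symm] at h2
    have h3 : (2 * ρ) • mixed G ρ u z i = (2 * ρ) • mixed G ρ u z j := by
      rw [eq_neg_add_iff_add_eq] at h1 h2
      exact (h2.symm.trans (add_comm _ _)).trans h1
    exact smul_right_injective E (by positivity : (2 * ρ) ≠ 0) h3
  have hconst : ∀ j, mixed G ρ u z j = mixed G ρ u z i := by
    intro j
    obtain ⟨p⟩ := hG.preconnected j i
    induction p with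
    | nil => rfl
    | cons h _ ih => rw [hadj _ _ h, ih]
  -- Summing the fixed-point equations over all darts counts each `z d` twice; the result cancels
  -- the degree terms in the sum of the defining relations.
  have hsum : ∑ d, z d = ρ • ∑ j, (G.degree j : ℝ) • mixed G ρ u z j := by
    have h1 : ∑ d : G.Dart, (z d + z d.symm) = ∑ d : G.Dart, (2 * ρ) • mixed G ρ u z d.symm.fst :=
      Finset.sum_congr rfl fun d _ => by
        have := hz d
        rw [eq_neg_add_iff_add_eq] at this
        rw [add_comm, this]
        rfl
    rw [sum_dart_symm (fun d => (2 * ρ) • mixed G ρ u z d.fst), Finset.sum_add_distrib,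
      sum_dart_symm, ← Finset.smul_sum, sum_dart_of_fst, ← two_smul ℝ, mul_smul] at h1
    exact smul_right_injective E (two_ne_zero (α := ℝ)) h1
  have htot : ∑ j, (1 + ρ * (G.degree j : ℝ)) • mixed G ρ u z j = ∑ j, u j + ∑ d, z d := by
    rw [Finset.sum_congr rfl fun j _ => smul_mixed hρ u z j, Finset.sum_add_distrib, sum_dart_fst]
  rw [hsum] at htot
  simp only [add_smul, one_smul, Finset.sum_add_distrib, mul_smul, ← Finset.smul_sum] at htot
  have h4 := add_right_cancel htot
  rw [Finset.sum_congr rfl fun j _ => hconst j, Finset.sum_const, Finset.card_univ,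
    Fintype.card_fin, ← Nat.cast_smul_eq_nsmul ℝ] at h4
  have hN : (N : ℝ) ≠ 0 := by
    have := i.pos
    positivity
  rw [← h4, smul_smul, inv_mul_cancel₀ hN, one_smul]

variable (G E) in
/-- The linear part of the message exchange, as an operator on the Hilbert space of edge
variables. -/
noncomputable def exchangeLin (ρ : ℝ) :
    PiLp 2 (fun _ : G.Dart => E) →ₗ[ℝ] PiLp 2 (fun _ : G.Dart => E) where
  toFun w := WithLp.toLp 2 fun d => -w d.symm + (2 * ρ) • mixed G ρ 0 w.ofLp d.snd
  map_add' w w' := by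
    ext d
    have := mixed_add ρ 0 0 w.ofLp w'.ofLp d.snd
    rw [add_zero] at this
    simp only [PiLp.add_apply, WithLp.ofLp_add, this, smul_add]
    abel
  map_smul' c w := by
    ext d
    have := mixed_smul ρ c 0 w.ofLp d.snd
    rw [smul_zero] at this
    simp only [PiLp.smul_apply, WithLp.ofLp_smul, this, RingHom.id_apply, smul_add, smul_neg]
    rw [smul_comm c]

/-- Reversing darts is an isometry, so the norm can be computed vertex by vertex. With `m` the local
value, the edge variables at a vertex of degree `d` sum to `(1 + ρd)m`, and the change in squared
norm is `(-4ρ(1 + ρd) + 4ρ²d)‖m‖² = -4ρ‖m‖²`. -/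
theorem norm_sq_exchange {ρ : ℝ} (hρ : 0 < ρ) (w : PiLp 2 (fun _ : G.Dart => E)) :
    ‖exchangeLin G E ρ w‖ ^ 2 =
      ‖w‖ ^ 2 - ∑ i, 4 * ρ * ‖mixed G ρ 0 w.ofLp i‖ ^ 2 := by
  rw [PiLp.norm_sq_eq_of_L2, PiLp.norm_sq_eq_of_L2]
  have h1 : ∑ d, ‖(exchangeLin G E ρ w).ofLp d‖ ^ 2
      = ∑ d : G.Dart, ‖-w d + (2 * ρ) • mixed G ρ 0 w.ofLp d.fst‖ ^ 2 := by
    rw [← sum_dart_symm (fun d => ‖-w d + (2 * ρ) • mixed G ρ 0 w.ofLp d.fst‖ ^ 2)]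
    rfl
  rw [h1, ← sum_dart_fst, ← sum_dart_fst, ← Finset.sum_sub_distrib]
  refine Finset.sum_congr rfl fun i _ => ?_
  set m := mixed G ρ 0 w.ofLp i with hm
  have h2 : ∀ d ∈ Finset.univ.filter (fun d : G.Dart => d.fst = i),
      ‖-w d + (2 * ρ) • mixed G ρ 0 w.ofLp d.fst‖ ^ 2
        = ‖w d‖ ^ 2 - 4 * ρ * inner ℝ (w d) m + (2 * ρ) ^ 2 * ‖m‖ ^ 2 := by
    intro d hd
    have hd' : d.fst = i := (Finset.mem_filter.1 hd).2
    rw [hd', ← hm, norm_add_sq_real, norm_neg, inner_neg_left, inner_smul_right, norm_smul,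
      mul_pow, Real.norm_eq_abs, sq_abs]
    ring
  have h3 : ∑ d : G.Dart with d.fst = i, inner ℝ (w d) m
      = (1 + ρ * (G.degree i : ℝ)) * ‖m‖ ^ 2 := by
    have := smul_mixed hρ 0 w.ofLp i
    rw [Pi.zero_apply, zero_add] at this
    rw [← sum_inner, ← this, inner_smul_left, ← hm, real_inner_self_eq_norm_sq]
    simp
  rw [Finset.sum_congr rfl h2, Finset.sum_add_distrib, Finset.sum_sub_distrib, ← Finset.mul_sum,
    h3, Finset.sum_const, G.dart_fst_fiber_card_eq_degree, nsmul_eq_mul]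
  ring

theorem norm_mixed_zero_le {ρ : ℝ} (hρ : 0 < ρ) (w : PiLp 2 (fun _ : G.Dart => E)) (i : Fin N) :
    ‖mixed G ρ 0 w.ofLp i‖ ≤ (Fintype.card G.Dart : ℝ) * ‖w‖ := by
  have h1 : ‖∑ d : G.Dart with d.fst = i, w d‖ ≤ (Fintype.card G.Dart : ℝ) * ‖w‖ := by
    calc ‖∑ d : G.Dart with d.fst = i, w d‖ ≤ ∑ d : G.Dart with d.fst = i, ‖w d‖ := norm_sum_le _ _
      _ ≤ ∑ d : G.Dart, ‖w d‖ :=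
        Finset.sum_le_sum_of_subset_of_nonneg (Finset.subset_univ _) fun _ _ _ => norm_nonneg _
      _ ≤ ∑ _d : G.Dart, ‖w‖ := Finset.sum_le_sum fun d _ => PiLp.norm_apply_le w d
      _ = _ := by simp
  have h2 : 1 ≤ 1 + ρ * (G.degree i : ℝ) := by
    have : 0 ≤ ρ * (G.degree i : ℝ) := by positivity
    linarith
  rw [mixed, Pi.zero_apply, zero_add, norm_smul, Real.norm_of_nonneg (by positivity)]
  calc 1 / (1 + ρ * (G.degree i : ℝ)) * _ ≤ 1 * ‖∑ d : G.Dart with d.fst = i, w d‖ := by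
        gcongr
        exact div_le_one_of_le₀ h2 (by positivity)
    _ ≤ _ := by rwa [one_mul]

variable [FiniteDimensional ℝ E]

variable (G E) in
/-- `exchangeLin` as a continuous linear map. -/
noncomputable def exchange (ρ : ℝ) :
    PiLp 2 (fun _ : G.Dart => E) →L[ℝ] PiLp 2 (fun _ : G.Dart => E) :=
  LinearMap.toContinuousLinearMap (exchangeLin G E ρ)

theorem exchange_apply (ρ : ℝ) (w : PiLp 2 (fun _ : G.Dart => E)) (d : G.Dart) :
    exchange G E ρ w d = -w d.symm + (2 * ρ) • mixed G ρ 0 w.ofLp d.snd := rfl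

theorem norm_exchange_le {ρ : ℝ} (hρ : 0 < ρ) (w : PiLp 2 (fun _ : G.Dart => E)) :
    ‖exchange G E ρ w‖ ≤ ‖w‖ := by
  have h1 : ‖exchange G E ρ w‖ ^ 2 = _ := norm_sq_exchange hρ w
  have h2 : 0 ≤ ∑ i, 4 * ρ * ‖mixed G ρ 0 w.ofLp i‖ ^ 2 :=
    Finset.sum_nonneg fun i _ => by positivity
  exact le_of_sq_le_sq (by linarith) (norm_nonneg _)

/-- A fixed vector loses no norm, so every loss term vanishes: the fixed part of the edge variables
is invisible to the agents. -/
theorem mixed_eq_zero_of_fixed {ρ : ℝ} (hρ : 0 < ρ) {w : PiLp 2 (fun _ : G.Dart => E)}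
    (hw : exchange G E ρ w = w) (i : Fin N) : mixed G ρ 0 w.ofLp i = 0 := by
  have h1 : ‖exchange G E ρ w‖ ^ 2 = _ := norm_sq_exchange hρ w
  rw [hw, eq_comm, sub_eq_self, Finset.sum_eq_zero_iff_of_nonneg fun i _ => by positivity] at h1
  have h2 := h1 i (Finset.mem_univ i)
  simpa [hρ.ne'] using h2

variable (G E) in
/-- The input term of the edge dynamics. -/
noncomputable def inputLin (ρ : ℝ) : (Fin N → E) →ₗ[ℝ] PiLp 2 (fun _ : G.Dart => E) where
  toFun u := WithLp.toLp 2 fun d => (2 * ρ) • mixed G ρ u 0 d.snd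
  map_add' u u' := by
    ext d
    have := mixed_add ρ u u' (0 : G.Dart → E) 0 d.snd
    rw [add_zero] at this
    simp only [PiLp.add_apply, this, smul_add]
  map_smul' c u := by
    ext d
    have := mixed_smul ρ c u (0 : G.Dart → E) d.snd
    rw [smul_zero] at this
    simp only [PiLp.smul_apply, this, RingHom.id_apply]
    rw [smul_comm c]

variable (G E) in
/-- `inputLin` as a continuous linear map. -/
noncomputable def input (ρ : ℝ) : (Fin N → E) →L[ℝ] PiLp 2 (fun _ : G.Dart => E) :=
  LinearMap.toContinuousLinearMap (inputLin G E ρ)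

theorem input_apply (ρ : ℝ) (u : Fin N → E) (d : G.Dart) :
    input G E ρ u d = (2 * ρ) • mixed G ρ u 0 d.snd := rfl

theorem edgeStep_eq (ρ α : ℝ) (u : Fin N → E) (z : PiLp 2 (fun _ : G.Dart => E)) :
    WithLp.toLp 2 (edgeStep G ρ α u z.ofLp)
      = (1 - α) • z + α • (exchange G E ρ z + input G E ρ u) := by
  ext d
  have := mixed_add ρ 0 u z.ofLp 0 d.snd
  rw [zero_add, add_zero] at this
  simp only [edgeStep, PiLp.add_apply, PiLp.smul_apply, exchange_apply, input_apply, this,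
    smul_add, add_assoc]

/-- Fixed vectors are circulations: antisymmetric under reversal, with zero sum at each vertex. The
input depends only on the head of a dart, so it is orthogonal to them. -/
theorem input_mem_orthogonal {ρ : ℝ} (hρ : 0 < ρ) (u : Fin N → E) :
    input G E ρ u ∈ (fixedSubspace (exchange G E ρ))ᗮ := by
  rw [Submodule.mem_orthogonal]
  intro w hw
  rw [mem_fixedSubspace] at hw
  have h0 : ∀ i, ∑ d : G.Dart with d.fst = i, w d = 0 := by
    intro i
    have := smul_mixed hρ 0 w.ofLp i
    rw [mixed_eq_zero_of_fixed hρ hw, Pi.zero_apply, zero_add, smul_zero] at this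
    exact this.symm
  have hanti : ∀ d, w d.symm = -w d := by
    intro d
    have : exchange G E ρ w d = w d := by rw [hw]
    rw [exchange_apply, mixed_eq_zero_of_fixed hρ hw, smul_zero, add_zero] at this
    rw [← this, neg_neg]
  rw [PiLp.inner_apply, ← sum_dart_symm, ← sum_dart_fst]
  refine Finset.sum_eq_zero fun i _ => ?_
  have h1 : ∀ d ∈ Finset.univ.filter (fun d : G.Dart => d.fst = i),
      inner ℝ (w d.symm) (input G E ρ u d.symm) = -inner ℝ (w d) ((2 * ρ) • mixed G ρ u 0 i) := by
    intro d hd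
    have hd' : d.symm.snd = i := (Finset.mem_filter.1 hd).2
    rw [input_apply, hd', hanti, inner_neg_left]
  rw [Finset.sum_congr rfl h1, Finset.sum_neg_distrib, ← sum_inner, h0, inner_zero_left, neg_zero]

/-- Linear convergence of the distributed averaging dynamics, with a varying input: there is an
error functional that controls the distance of the local estimates to the mean, contracts
geometrically, and is perturbed by at most a multiple of the variation of the input. -/
theorem exists_tracking_error (hG : G.Connected) {ρ : ℝ} (hρ : 0 < ρ) {α : ℝ}
    (hα : α ∈ Set.Ioo (0 : ℝ) 1) :
    ∃ (e : (Fin N → E) → (G.Dart → E) → ℝ) (η C : ℝ), η ∈ Set.Ioc (0 : ℝ) 1 ∧ 0 < C ∧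
      (∀ u z, 0 ≤ e u z) ∧
      (∀ u z, e u z ≤ C * (∑ i, ‖u i‖ + ∑ d, ‖z d‖)) ∧
      (∀ u z i, ‖mixed G ρ u z i - (N : ℝ)⁻¹ • ∑ j, u j‖ ≤ C * e u z) ∧
      (∀ u u' z, e u' (edgeStep G ρ α u z) ≤ (1 - η) * e u z + C * ∑ i, ‖u' i - u i‖) := by
  set M := exchange G E ρ
  have hM : ∀ w, ‖M w‖ ≤ ‖w‖ := norm_exchange_le hρ
  obtain ⟨η, hη, hcontr⟩ := exists_averaged_contraction hM hα
  obtain ⟨R, hR⟩ := exists_inverse_on_orthogonal_fixed hM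
  set Q := (fixedSubspace M)ᗮ.starProjection with hQ
  -- `h u` is the equilibrium for the frozen input `u`, chosen in the complement; the error
  -- functional is the distance from it to the projected edge variables.
  set h : (Fin N → E) →L[ℝ] PiLp 2 (fun _ : G.Dart => E) := R.comp (input G E ρ) with hh
  have hmem : ∀ u, h u ∈ (fixedSubspace M)ᗮ := fun u => (hR _ (input_mem_orthogonal hρ u)).1
  have heq : ∀ u, h u = M (h u) + input G E ρ u := fun u => (hR _ (input_mem_orthogonal hρ u)).2
  have hsup : ∀ u : Fin N → E, ‖u‖ ≤ ∑ i, ‖u i‖ := fun u =>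
    (pi_norm_le_iff_of_nonneg (Finset.sum_nonneg fun _ _ => norm_nonneg _)).2 fun i =>
      Finset.single_le_sum (f := fun i => ‖u i‖) (fun _ _ => norm_nonneg _) (Finset.mem_univ i)
  have hnz : ∀ z : G.Dart → E, ‖WithLp.toLp 2 z‖ ≤ ∑ d, ‖z d‖ := by
    intro z
    refine le_of_sq_le_sq ?_ (Finset.sum_nonneg fun _ _ => norm_nonneg _)
    rw [PiLp.norm_sq_eq_of_L2]
    exact Finset.sum_sq_le_sq_sum_of_nonneg fun _ _ => norm_nonneg _
  set C : ℝ := 1 + ‖h‖ + (Fintype.card G.Dart : ℝ) with hC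
  have hcard : (0 : ℝ) ≤ Fintype.card G.Dart := Nat.cast_nonneg _
  have hhn := norm_nonneg h
  refine ⟨fun u z => ‖Q (WithLp.toLp 2 z) - h u‖, η, C, hη, by linarith, fun _ _ => norm_nonneg _,
    ?_, ?_, ?_⟩
  · intro u z
    have hu : 0 ≤ ∑ i, ‖u i‖ := Finset.sum_nonneg fun _ _ => norm_nonneg _
    have hz : 0 ≤ ∑ d, ‖z d‖ := Finset.sum_nonneg fun _ _ => norm_nonneg _
    calc ‖Q (WithLp.toLp 2 z) - h u‖ ≤ ‖Q (WithLp.toLp 2 z)‖ + ‖h u‖ := norm_sub_le _ _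
      _ ≤ ∑ d, ‖z d‖ + ‖h‖ * ∑ i, ‖u i‖ := by
        gcongr
        · exact (Submodule.norm_starProjection_apply_le _ _).trans (hnz z)
        · exact (h.le_opNorm u).trans (by gcongr; exact hsup u)
      _ ≤ C * (∑ i, ‖u i‖ + ∑ d, ‖z d‖) := by rw [hC]; nlinarith
  · intro u z i
    set w := Q (WithLp.toLp 2 z) - h u
    set k := WithLp.toLp 2 z - Q (WithLp.toLp 2 z)
    have hk : M k = k := by
      have := Submodule.sub_starProjection_mem_orthogonal (K := (fixedSubspace M)ᗮ)
        (WithLp.toLp 2 z)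
      rw [Submodule.orthogonal_orthogonal] at this
      exact mem_fixedSubspace.1 this
    -- Equilibrium, error and fixed part: the first yields the mean, the last contributes nothing,
    -- so only `w` causes a deviation.
    have hz : z = (h u).ofLp + (w.ofLp + k.ofLp) := by
      have a0 : WithLp.toLp 2 z = h u + (w + k) := by simp [w, k]
      exact congrArg WithLp.ofLp a0
    have h1 : mixed G ρ u z i = mixed G ρ u (h u).ofLp i + mixed G ρ 0 w.ofLp i := by
      have a1 := mixed_add ρ u 0 (h u).ofLp (w.ofLp + k.ofLp) i
      have a2 := mixed_add ρ 0 0 w.ofLp k.ofLp i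
      rw [add_zero, mixed_eq_zero_of_fixed hρ hk, add_zero] at a2
      rw [a2, add_zero, ← hz] at a1
      exact a1
    have h2 : mixed G ρ u (h u).ofLp i = (N : ℝ)⁻¹ • ∑ j, u j := by
      refine mixed_eq_mean hG hρ (fun d => ?_) i
      have a1 : h u d = (M (h u) + input G E ρ u) d := congrArg (fun v => v.ofLp d) (heq u)
      rw [PiLp.add_apply, exchange_apply, input_apply] at a1
      have a2 := mixed_add ρ 0 u (h u).ofLp 0 d.snd
      rw [zero_add, add_zero] at a2
      rw [a2, smul_add, ← add_assoc]
      exact a1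
    rw [h1, h2, add_sub_cancel_left]
    refine (norm_mixed_zero_le hρ w i).trans ?_
    gcongr
    linarith
  · intro u u' z
    have hQi : Q (input G E ρ u) = input G E ρ u :=
      Submodule.starProjection_eq_self_iff.2 (input_mem_orthogonal hρ u)
    -- Subtracting the equilibrium equation leaves the averaged homogeneous dynamics, plus the drift
    -- `h (u' - u)` of the equilibrium.
    have h1 : Q (WithLp.toLp 2 (edgeStep G ρ α u z)) - h u'
        = ((1 - α) • (Q (WithLp.toLp 2 z) - h u) + α • M (Q (WithLp.toLp 2 z) - h u))
          - h (u' - u) := by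
      have a1 := edgeStep_eq ρ α u (WithLp.toLp 2 z)
      have a2 : input G E ρ u = h u - M (h u) := by
        rw [eq_sub_iff_add_eq, add_comm]; exact (heq u).symm
      have a3 : Q (M (WithLp.toLp 2 z)) = M (Q (WithLp.toLp 2 z)) :=
        starProjection_orthogonal_fixed_apply hM _
      change WithLp.toLp 2 (edgeStep G ρ α u z) = _ at a1
      rw [a1, map_add, map_smul, map_smul, map_add, hQi, a3, a2, map_sub, map_sub]
      module
    change ‖Q (WithLp.toLp 2 (edgeStep G ρ α u z)) - h u'‖ ≤ _
    rw [h1]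
    refine (norm_sub_le _ _).trans (add_le_add (hcontr _ ?_) ?_)
    · exact Submodule.sub_mem _ (Submodule.starProjection_apply_mem _ _) (hmem u)
    · calc ‖h (u' - u)‖ ≤ ‖h‖ * ‖u' - u‖ := h.le_opNorm _
        _ ≤ C * ∑ i, ‖u' i - u i‖ := by
          gcongr
          · linarith
          · exact hsup (u' - u)

end Tracker

end ADMMTracking

/-! ### Strong convexity and gradient steps. -/

section StrongConvexity

variable {E : Type*} [NormedAddCommGroup E] [InnerProductSpace ℝ E] [CompleteSpace E]

/-- Divide the strong convexity inequality on the segment by `t` and let `t` tend to zero from the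
right. -/
theorem StrongConvexOn.add_inner_gradient_le {F : E → ℝ} {g : E → E} {μ : ℝ}
    (hF : StrongConvexOn Set.univ μ F) (hg : ∀ x, HasGradientAt F (g x) x) (x y : E) :
    F x + inner ℝ (g x) (y - x) + μ / 2 * ‖y - x‖ ^ 2 ≤ F y := by
  have h1 := ((hg x).hasFDerivAt.hasLineDerivAt (y - x)).tendsto_slope_zero_right
  rw [InnerProductSpace.toDual_apply_apply] at h1
  have h2 : Filter.Tendsto (fun t : ℝ => F y - F x - (1 - t) * (μ / 2 * ‖x - y‖ ^ 2))
      (nhdsWithin 0 (Set.Ioi 0)) (nhds (F y - F x - (1 - 0) * (μ / 2 * ‖x - y‖ ^ 2))) :=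
    (Continuous.tendsto (by fun_prop) 0).mono_left nhdsWithin_le_nhds
  have h3 := le_of_tendsto_of_tendsto h1 h2 (by
    filter_upwards [Ioo_mem_nhdsGT (zero_lt_one (α := ℝ))] with t ht
    have h4 : F ((1 - t) • x + t • y)
        ≤ (1 - t) • F x + t • F y - (1 - t) * t * (μ / 2 * ‖x - y‖ ^ 2) :=
      hF.2 (Set.mem_univ x) (Set.mem_univ y) (sub_nonneg.2 ht.2.le) ht.1.le (by ring)
    have h5 : (1 - t) • x + t • y = x + t • (y - x) := by module
    simp only [h5, smul_eq_mul] at h4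
    rw [smul_eq_mul, inv_mul_le_iff₀ ht.1]
    linarith)
  rw [norm_sub_rev x y] at h3
  linarith

theorem StrongConvexOn.inner_gradient_sub_ge {F : E → ℝ} {g : E → E} {μ : ℝ}
    (hF : StrongConvexOn Set.univ μ F) (hg : ∀ x, HasGradientAt F (g x) x) (x y : E) :
    μ * ‖x - y‖ ^ 2 ≤ inner ℝ (g x - g y) (x - y) := by
  have h1 := hF.add_inner_gradient_le hg x y
  have h2 := hF.add_inner_gradient_le hg y x
  rw [← neg_sub x y, inner_neg_right, norm_neg] at h1
  rw [inner_sub_left]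
  linarith

/-- A short gradient step on a strongly convex smooth function is a contraction. -/
theorem StrongConvexOn.norm_gradient_step_le {F : E → ℝ} {g : E → E} {μ Λ s : ℝ}
    (hF : StrongConvexOn Set.univ μ F) (hg : ∀ x, HasGradientAt F (g x) x)
    (hΛ : ∀ x y, ‖g x - g y‖ ≤ Λ * ‖x - y‖) (hs : 0 ≤ s) (hsΛ : s * Λ ^ 2 ≤ μ) (x y : E) :
    ‖(x - s • g x) - (y - s • g y)‖ ≤ (1 - s * μ / 2) * ‖x - y‖ := by
  by_cases hxy : x = y
  · simp [hxy]
  have hn : 0 < ‖x - y‖ := norm_pos_iff.2 (sub_ne_zero.2 hxy)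
  have h1 : ‖(x - s • g x) - (y - s • g y)‖ ^ 2 ≤ (1 - s * μ) * ‖x - y‖ ^ 2 := by
    have h2 : (x - s • g x) - (y - s • g y) = (x - y) - s • (g x - g y) := by module
    rw [h2, norm_sub_sq_real, inner_smul_right, real_inner_comm, norm_smul, mul_pow,
      Real.norm_of_nonneg hs]
    have h3 := mul_le_mul_of_nonneg_left (hF.inner_gradient_sub_ge hg x y) hs
    have h4 : ‖g x - g y‖ ^ 2 ≤ Λ ^ 2 * ‖x - y‖ ^ 2 := by
      rw [← mul_pow]
      gcongr
      exact hΛ x y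
    have h5 := mul_le_mul_of_nonneg_left h4 (sq_nonneg s)
    have h6 := mul_le_mul_of_nonneg_right (mul_le_mul_of_nonneg_left hsΛ hs) (sq_nonneg ‖x - y‖)
    linarith
  -- Otherwise `h1` would bound a square by a negative number.
  have h7 : 0 ≤ 1 - s * μ := by
    by_contra! h
    nlinarith [sq_nonneg ‖(x - s • g x) - (y - s • g y)‖, pow_pos hn 2]
  refine le_of_sq_le_sq (h1.trans ?_) (mul_nonneg (by linarith) hn.le)
  rw [mul_pow]
  gcongr
  nlinarith [sq_nonneg (s * μ)]

/-- A critical point is the Banach fixed point of a short gradient step. -/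
theorem StrongConvexOn.exists_gradient_eq_zero {F : E → ℝ} {g : E → E} {μ Λ : ℝ} (hμ : 0 < μ)
    (hF : StrongConvexOn Set.univ μ F) (hg : ∀ x, HasGradientAt F (g x) x)
    (hΛ : ∀ x y, ‖g x - g y‖ ≤ Λ * ‖x - y‖) : ∃ x, g x = 0 := by
  set s : ℝ := μ / (Λ ^ 2 + 1) with hs
  have hs0 : 0 < s := by positivity
  have hsΛ : s * Λ ^ 2 ≤ μ := by
    rw [hs, div_mul_eq_mul_div, div_le_iff₀ (by positivity)]
    nlinarith
  have hK : ContractingWith (1 - s * μ / 2).toNNReal (fun x => x - s • g x) := by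
    refine ⟨?_, LipschitzWith.of_dist_le_mul fun x y => ?_⟩
    · rw [Real.toNNReal_lt_one]
      have := mul_pos hs0 hμ
      linarith
    · rw [dist_eq_norm, dist_eq_norm]
      exact (hF.norm_gradient_step_le hg hΛ hs0.le hsΛ x y).trans
        (by gcongr; exact Real.le_coe_toNNReal _)
  refine ⟨ContractingWith.fixedPoint _ hK, ?_⟩
  have h1 := ContractingWith.fixedPoint_isFixedPt hK
  rw [Function.IsFixedPt, sub_eq_self, smul_eq_zero] at h1
  exact h1.resolve_left hs0.ne'

theorem StrongConvexOn.lt_of_gradient_eq_zero {F : E → ℝ} {g : E → E} {μ : ℝ} (hμ : 0 < μ)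
    (hF : StrongConvexOn Set.univ μ F) (hg : ∀ x, HasGradientAt F (g x) x) {x y : E}
    (hx : g x = 0) (hxy : y ≠ x) : F x < F y := by
  have h1 := hF.add_inner_gradient_le hg x y
  rw [hx, inner_zero_left] at h1
  have h2 : 0 < ‖y - x‖ := norm_pos_iff.2 (sub_ne_zero.2 hxy)
  have : 0 < μ / 2 * ‖y - x‖ ^ 2 := by positivity
  linarith

end StrongConvexity

/-! ### Small-gain argument. -/

/-- A small-gain estimate for a slow-fast cascade: if `b` and `c` feed `a` with small gain, the sum
with suitable weights contracts, for every small enough step size `γ`. -/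
theorem exists_weighted_contraction {m C B η : ℝ} (hm : 0 < m) (hC : 0 < C) (hB : 0 ≤ B)
    (hη : η ∈ Set.Ioc (0 : ℝ) 1) :
    ∃ p q γbar : ℝ, 1 ≤ p ∧ 0 < q ∧ γbar ∈ Set.Ioc (0 : ℝ) (1 / 2) ∧
      ∀ δ ∈ Set.Ioo 0 B, ∀ γ ∈ Set.Ioo 0 γbar, ∃ ε ∈ Set.Ioo (0 : ℝ) 1,
        ∀ a b c a' b' c' : ℝ, 0 ≤ a → 0 ≤ b → 0 ≤ c →
          a' ≤ (1 - γ * δ * m) * a + γ * δ * C * b + γ * C * c →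
          b' ≤ (1 - γ) * b + γ * C * c →
          c' ≤ (1 - η) * c + γ * C * (b + δ * a + c) →
          a' + p * b' + q * c' ≤ (1 - ε) * (a + p * b + q * c) := by
  -- `q` makes the feedback of `a` through `c` cost half of the decay `γδm`. This works uniformly in
  -- `δ` because that feedback also carries the factor `δ`. Then `p` makes half of the decay of `b`
  -- absorb its couplings, and `r` bounds `γ` so that half of the decay of `c` absorbs the rest.
  set q : ℝ := m / (2 * C) with hq
  have hq0 : 0 < q := by positivity
  have hqC : q * C = m / 2 := by rw [hq]; field_simp
  set p : ℝ := 1 + 2 * (B * C + q * C) with hp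
  have hp0 : 0 < p := by positivity
  set r : ℝ := q * η / (2 * (C * (1 + p + q))) with hr
  have hη0 := hη.1
  have hr0 : 0 < r := by positivity
  refine ⟨p, q, min (1 / 2) r, ?_, hq0, ⟨lt_min (by norm_num) hr0, min_le_left _ _⟩, ?_⟩
  · have : 0 ≤ 2 * (B * C + q * C) := by positivity
    linarith
  rintro δ ⟨hδ, hδB⟩ γ ⟨hγ, hγr⟩
  have hγ2 : γ < 1 / 2 := hγr.trans_le (min_le_left _ _)
  have hγ3 : γ * (C * (1 + p + q)) ≤ q * η / 2 := by
    have h1 : γ ≤ r := (hγr.trans_le (min_le_right _ _)).le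
    calc γ * (C * (1 + p + q)) ≤ r * (C * (1 + p + q)) := by gcongr
      _ = q * η / 2 := by rw [hr]; field_simp
  set ε : ℝ := min (γ * δ * m / 2) (min (γ / 2) (η / 2)) with hε
  have hε1 : ε ≤ γ * δ * m / 2 := min_le_left _ _
  have hε2 : ε ≤ γ / 2 := (min_le_right _ _).trans (min_le_left _ _)
  have hε3 : ε ≤ η / 2 := (min_le_right _ _).trans (min_le_right _ _)
  refine ⟨ε, ⟨lt_min (by positivity) (lt_min (by positivity) (by positivity)), by linarith⟩, ?_⟩
  intro a b c a' b' c' ha hb hc h1 h2 h3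
  have h2' := mul_le_mul_of_nonneg_left h2 hp0.le
  have h3' := mul_le_mul_of_nonneg_left h3 hq0.le
  have ka : (1 - γ * δ * m + q * (γ * C * δ)) * a ≤ (1 - ε) * a := by
    gcongr
    have : q * (γ * C * δ) = γ * δ * m / 2 := by
      calc q * (γ * C * δ) = γ * δ * (q * C) := by ring
        _ = _ := by rw [hqC]; ring
    linarith
  have kb : (γ * δ * C + p * (1 - γ) + q * (γ * C)) * b ≤ (1 - ε) * p * b := by
    gcongr
    have e1 : γ * δ * C ≤ γ * (B * C) := by
      rw [mul_assoc]
      gcongr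
    have e2 : γ * (B * C + q * C) ≤ γ * (p / 2) := by
      gcongr
      linarith
    have e3 : ε * p ≤ γ / 2 * p := by gcongr
    linarith
  have kc : (γ * C + p * (γ * C) + q * (1 - η) + q * (γ * C)) * c ≤ (1 - ε) * q * c := by
    gcongr
    have e3 : ε * q ≤ η / 2 * q := by gcongr
    linarith
  linarith

/-! ### Perturbed consensus and gradient descent. -/

section SlowStep

variable {E : Type*} [NormedAddCommGroup E] [NormedSpace ℝ E] {N : ℕ}

/-- The arithmetic mean of a family of vectors. -/
noncomputable def mean (x : Fin N → E) : E := (N : ℝ)⁻¹ • ∑ i, x i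

theorem norm_mean_le {x : Fin N → E} {D : ℝ} (hN : 0 < N) (hD : ∀ i, ‖x i‖ ≤ D) :
    ‖mean x‖ ≤ D := by
  have hN' : (0 : ℝ) < N := Nat.cast_pos.2 hN
  rw [mean, norm_smul, norm_inv, Real.norm_natCast, inv_mul_le_iff₀ hN']
  calc ‖∑ i, x i‖ ≤ ∑ i, ‖x i‖ := norm_sum_le _ _
    _ ≤ ∑ _i : Fin N, D := Finset.sum_le_sum fun i _ => hD i
    _ = N * D := by simp

theorem card_mul_norm_mean_le (hN : 0 < N) (x : Fin N → E) : N * ‖mean x‖ ≤ ∑ i, ‖x i‖ := by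
  have hN' : (0 : ℝ) < N := Nat.cast_pos.2 hN
  rw [mean, norm_smul, norm_inv, Real.norm_natCast, ← mul_assoc, mul_inv_cancel₀ hN'.ne', one_mul]
  exact norm_sum_le _ _

theorem norm_mean_le_sum (hN : 0 < N) (x : Fin N → E) : ‖mean x‖ ≤ ∑ i, ‖x i‖ := by
  have hN' : (1 : ℝ) ≤ N := by exact_mod_cast hN
  have := card_mul_norm_mean_le hN x
  nlinarith [norm_nonneg (mean x)]

theorem mean_add (x y : Fin N → E) : mean (x + y) = mean x + mean y := by
  simp [mean, Finset.sum_add_distrib]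

theorem mean_smul (c : ℝ) (x : Fin N → E) : mean (c • x) = c • mean x := by
  simp only [mean, Pi.smul_apply, ← Finset.smul_sum]
  rw [smul_comm]

theorem mean_sub (x y : Fin N → E) : mean (x - y) = mean x - mean y := by
  simp [mean, smul_sub]

theorem mean_const (hN : 0 < N) (v : E) : mean (fun _ : Fin N => v) = v := by
  have hN' : (N : ℝ) ≠ 0 := by positivity
  rw [mean, Finset.sum_const, Finset.card_univ, Fintype.card_fin, ← Nat.cast_smul_eq_nsmul ℝ,
    smul_smul, inv_mul_cancel₀ hN', one_smul]

/-- The consensus error. -/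
noncomputable def spread (x : Fin N → E) : ℝ := ∑ i, ‖x i - mean x‖

theorem spread_nonneg (x : Fin N → E) : 0 ≤ spread x := Finset.sum_nonneg fun _ _ => norm_nonneg _

theorem spread_le (hN : 0 < N) (x : Fin N → E) : spread x ≤ 2 * ∑ i, ‖x i‖ := by
  calc spread x ≤ ∑ i, (‖x i‖ + ‖mean x‖) := Finset.sum_le_sum fun i _ => norm_sub_le _ _
    _ = ∑ i, ‖x i‖ + N * ‖mean x‖ := by simp [Finset.sum_add_distrib]
    _ ≤ _ := by linarith [card_mul_norm_mean_le hN x]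

theorem norm_sub_le_spread (x : Fin N → E) (i : Fin N) : ‖x i - mean x‖ ≤ spread x :=
  Finset.single_le_sum (f := fun i => ‖x i - mean x‖) (fun _ _ => norm_nonneg _)
    (Finset.mem_univ i)

section Step

variable {x x' r : Fin N → E} {v : E} {γ s : ℝ}

theorem mean_step (hN : 0 < N)
    (hx' : ∀ i, x' i = x i + γ • (mean x - x i) - s • v + γ • r i) :
    mean x' = mean x - s • v + γ • mean r := by
  have h1 : x' = x + γ • ((fun _ => mean x) - x) - s • (fun _ => v) + γ • r := by
    ext i
    simp [hx']
  rw [h1, mean_add, mean_sub, mean_add, mean_smul, mean_smul, mean_smul, mean_sub, mean_const hN,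
    mean_const hN, sub_self, smul_zero, add_zero]

/-- The common direction `v` moves all agents equally and cancels in the deviations from the mean.
-/
theorem spread_step (hN : 0 < N) (hγ : γ ∈ Set.Ioo (0 : ℝ) 1)
    (hx' : ∀ i, x' i = x i + γ • (mean x - x i) - s • v + γ • r i) {D : ℝ}
    (hr : ∀ i, ‖r i‖ ≤ D) : spread x' ≤ (1 - γ) * spread x + γ * (2 * N * D) := by
  have h1 : ∀ i, x' i - mean x' = (1 - γ) • (x i - mean x) + γ • (r i - mean r) := by
    intro i
    rw [mean_step hN hx', hx' i]
    module
  calc spread x' ≤ ∑ i, ((1 - γ) * ‖x i - mean x‖ + γ * (D + D)) := by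
        refine Finset.sum_le_sum fun i _ => ?_
        rw [h1]
        refine (norm_add_le _ _).trans ?_
        rw [norm_smul, norm_smul, Real.norm_of_nonneg hγ.1.le,
          Real.norm_of_nonneg (by linarith [hγ.2])]
        have := hγ.1.le
        gcongr
        exact (norm_sub_le _ _).trans (add_le_add (hr i) (norm_mean_le hN hr))
    _ = (1 - γ) * spread x + γ * (2 * N * D) := by
        rw [Finset.sum_add_distrib, ← Finset.mul_sum, spread]
        simp
        ring

theorem variation_step (hγ : 0 ≤ γ) (hs : 0 ≤ s)
    (hx' : ∀ i, x' i = x i + γ • (mean x - x i) - s • v + γ • r i) {D : ℝ}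
    (hr : ∀ i, ‖r i‖ ≤ D) :
    ∑ i, ‖x' i - x i‖ ≤ γ * spread x + s * (N * ‖v‖) + γ * (N * D) := by
  calc ∑ i, ‖x' i - x i‖ ≤ ∑ i, (γ * ‖x i - mean x‖ + s * ‖v‖ + γ * D) := by
        refine Finset.sum_le_sum fun i _ => ?_
        have h1 : x' i - x i = (-(γ • (x i - mean x)) - s • v) + γ • r i := by
          rw [hx' i]
          module
        rw [h1]
        refine (norm_add_le _ _).trans (add_le_add ((norm_sub_le _ _).trans ?_) ?_)
        · rw [norm_neg, norm_smul, norm_smul, Real.norm_of_nonneg hγ, Real.norm_of_nonneg hs]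
        · rw [norm_smul, Real.norm_of_nonneg hγ]
          gcongr
          exact hr i
    _ = _ := by
        rw [Finset.sum_add_distrib, Finset.sum_add_distrib, ← Finset.mul_sum, spread]
        simp
        ring

variable {g : Fin N → E → E} {L : ℝ}

theorem norm_mean_sub_mean_le (hN : 0 < N) (hL : ∀ i x y, ‖g i x - g i y‖ ≤ L * ‖x - y‖)
    (x : Fin N → E) (y : E) :
    N * ‖mean (fun i => g i (x i)) - mean (fun i => g i y)‖ ≤ L * ∑ i, ‖x i - y‖ := by
  rw [← mean_sub, Finset.mul_sum]
  exact (card_mul_norm_mean_le hN _).trans (Finset.sum_le_sum fun i _ => hL i _ _)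

/-- The mean takes an exact gradient step at itself; evaluating gradients at the separate estimates
costs at most `L` times the spread. -/
theorem error_step (hN : 0 < N) (hγ : 0 ≤ γ) (hs : 0 ≤ s)
    (hL : ∀ i x y, ‖g i x - g i y‖ ≤ L * ‖x - y‖)
    (hx' : ∀ i, x' i = x i + γ • (mean x - x i) - s • mean (fun i => g i (x i)) + γ • r i)
    {D : ℝ} (hr : ∀ i, ‖r i‖ ≤ D) {xs : E} {θ : ℝ}
    (hθ : ‖mean x - s • mean (fun i => g i (mean x)) - xs‖ ≤ θ * ‖mean x - xs‖) :
    ‖mean x' - xs‖ ≤ θ * ‖mean x - xs‖ + s * (L * spread x) + γ * D := by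
  have h1 : mean x' - xs = (mean x - s • mean (fun i => g i (mean x)) - xs)
      - s • (mean (fun i => g i (x i)) - mean (fun i => g i (mean x))) + γ • mean r := by
    rw [mean_step hN hx']
    module
  have h2 := norm_mean_sub_mean_le hN hL x (mean x)
  have hN' : (1 : ℝ) ≤ N := by exact_mod_cast hN
  rw [h1]
  refine (norm_add_le _ _).trans (add_le_add ((norm_sub_le _ _).trans (add_le_add hθ ?_)) ?_)
  · rw [norm_smul, Real.norm_of_nonneg hs]
    gcongr
    refine le_trans ?_ h2
    exact le_mul_of_one_le_left (norm_nonneg _) hN'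
  · rw [norm_smul, Real.norm_of_nonneg hγ]
    gcongr
    exact norm_mean_le hN hr

theorem card_mul_norm_mean_gradient_le (hN : 0 < N) (hL0 : 0 ≤ L)
    (hL : ∀ i x y, ‖g i x - g i y‖ ≤ L * ‖x - y‖) {xs : E} (hxs : mean (fun i => g i xs) = 0) :
    N * ‖mean (fun i => g i (x i))‖ ≤ L * (spread x + N * ‖mean x - xs‖) := by
  have h1 := norm_mean_sub_mean_le hN hL x xs
  rw [hxs, sub_zero] at h1
  refine h1.trans (mul_le_mul_of_nonneg_left ?_ hL0)
  calc ∑ i, ‖x i - xs‖ ≤ ∑ i, (‖x i - mean x‖ + ‖mean x - xs‖) :=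
        Finset.sum_le_sum fun i _ => by
          rw [← sub_add_sub_cancel (x i) (mean x) xs]
          exact norm_add_le _ _
    _ = _ := by rw [Finset.sum_add_distrib, spread]; simp

end Step

end SlowStep

/-! ### The algorithm as a coupling of the two subsystems. -/

namespace ADMMTracking

variable {N n : ℕ} {G : SimpleGraph (Fin N)} [DecidableRel G.Adj] (f : Fin N → Vec n → ℝ)

/-- The local gradients at the current estimates. -/
noncomputable def localGradient (S : State G n) (i : Fin N) : Vec n := gradient (f i) (S.x i)

theorem proxy_fst (ρ : ℝ) (S : State G n) (i : Fin N) :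
    (proxy G f ρ S i).1 = mixed G ρ S.x (fun d => (S.z d).1) i := by
  simp [proxy, mixed, Prod.fst_sum]

theorem proxy_snd (ρ : ℝ) (S : State G n) (i : Fin N) :
    (proxy G f ρ S i).2 = mixed G ρ (localGradient f S) (fun d => (S.z d).2) i := by
  simp [proxy, mixed, Prod.snd_sum, localGradient]

theorem step_z_fst (ρ α γ δ : ℝ) (S : State G n) :
    (fun d => ((step G f ρ α γ δ S).z d).1) = edgeStep G ρ α S.x (fun d => (S.z d).1) := by
  ext1 d
  simp only [step, edgeStep, message, Prod.fst_add, Prod.smul_fst, Prod.fst_neg, proxy_fst]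
  rfl

theorem step_z_snd (ρ α γ δ : ℝ) (S : State G n) :
    (fun d => ((step G f ρ α γ δ S).z d).2)
      = edgeStep G ρ α (localGradient f S) (fun d => (S.z d).2) := by
  ext1 d
  simp only [step, edgeStep, message, Prod.snd_add, Prod.smul_snd, Prod.snd_neg, proxy_snd]
  rfl

/-- The estimates follow a perturbed step of consensus combined with gradient descent. -/
theorem step_x_eq (ρ α γ δ : ℝ) (S : State G n) (i : Fin N) :
    (step G f ρ α γ δ S).x i = S.x i + γ • (mean S.x - S.x i)
      - (γ * δ) • mean (localGradient f S)
      + γ • ((mixed G ρ S.x (fun d => (S.z d).1) i - mean S.x)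
        - δ • (mixed G ρ (localGradient f S) (fun d => (S.z d).2) i
          - mean (localGradient f S))) := by
  simp only [step, proxy_fst, proxy_snd]
  module

end ADMMTracking

namespace ADMMTracking

variable {N n : ℕ} {G : SimpleGraph (Fin N)} {f : Fin N → Vec n → ℝ}

theorem hasGradientAt_sum (hdiff : ∀ i, Differentiable ℝ (f i)) (x : Vec n) :
    HasGradientAt (fun x => ∑ i, f i x) (∑ i, gradient (f i) x) x := by
  rw [hasGradientAt_iff_hasFDerivAt, map_sum]
  exact HasFDerivAt.fun_sum fun i _ => ((hdiff i) x).hasGradientAt.hasFDerivAt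

theorem norm_sum_gradient_sub_le {L : ℝ}
    (hL : ∀ i x y, ‖gradient (f i) x - gradient (f i) y‖ ≤ L * ‖x - y‖) (x y : Vec n) :
    ‖∑ i, gradient (f i) x - ∑ i, gradient (f i) y‖ ≤ N * L * ‖x - y‖ := by
  rw [← Finset.sum_sub_distrib]
  calc _ ≤ ∑ i, ‖gradient (f i) x - gradient (f i) y‖ := norm_sum_le _ _
    _ ≤ ∑ _i : Fin N, L * ‖x - y‖ := Finset.sum_le_sum fun i _ => hL i x y
    _ = _ := by simp [mul_assoc]

/-- A step `s` along the mean gradient is a step `s / N` along the gradient of the sum, which is `N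
* L`-Lipschitz. -/
theorem norm_mean_gradient_step_le {μ L s : ℝ} (hN : 0 < N)
    (hdiff : ∀ i, Differentiable ℝ (f i))
    (hconv : StrongConvexOn Set.univ μ (fun x => ∑ i, f i x))
    (hL : ∀ i x y, ‖gradient (f i) x - gradient (f i) y‖ ≤ L * ‖x - y‖)
    {xs : Vec n} (hxs : ∑ i, gradient (f i) xs = 0) (hs : 0 ≤ s) (hsL : s * (N * L ^ 2) ≤ μ)
    (x : Vec n) :
    ‖x - s • mean (fun i => gradient (f i) x) - xs‖ ≤ (1 - s * (μ / (2 * N))) * ‖x - xs‖ := by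
  have hN' : (0 : ℝ) < N := Nat.cast_pos.2 hN
  have h1 := hconv.norm_gradient_step_le (hasGradientAt_sum hdiff) (norm_sum_gradient_sub_le hL)
    (s := s * (N : ℝ)⁻¹) (by positivity) (by
      have : s * (N : ℝ)⁻¹ * (N * L) ^ 2 = s * (N * L ^ 2) := by field_simp
      rwa [this]) x xs
  rw [hxs, smul_zero, sub_zero, mul_smul] at h1
  have h2 : 1 - s * (N : ℝ)⁻¹ * μ / 2 = 1 - s * (μ / (2 * N)) := by field_simp
  rwa [h2] at h1

theorem sum_norm_localGradient_sub_le {L : ℝ}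
    (hL : ∀ i x y, ‖gradient (f i) x - gradient (f i) y‖ ≤ L * ‖x - y‖) (S S' : State G n) :
    ∑ i, ‖localGradient f S' i - localGradient f S i‖ ≤ L * ∑ i, ‖S'.x i - S.x i‖ := by
  rw [Finset.mul_sum]
  exact Finset.sum_le_sum fun i _ => hL i _ _

theorem sum_norm_localGradient_le {L : ℝ}
    (hL : ∀ i x y, ‖gradient (f i) x - gradient (f i) y‖ ≤ L * ‖x - y‖) (S : State G n) :
    ∑ i, ‖localGradient f S i‖ ≤ L * ∑ i, ‖S.x i‖ + ∑ i, ‖gradient (f i) 0‖ := by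
  rw [Finset.mul_sum, ← Finset.sum_add_distrib]
  refine Finset.sum_le_sum fun i _ => ?_
  have h1 := hL i (S.x i) 0
  rw [sub_zero] at h1
  calc ‖localGradient f S i‖ = ‖(gradient (f i) (S.x i) - gradient (f i) 0) + gradient (f i) 0‖ := by
        rw [sub_add_cancel]; rfl
    _ ≤ _ := (norm_add_le _ _).trans (by gcongr)

variable [DecidableRel G.Adj]

/-- There is a tracking-error functional `c` which, together with the optimality and consensus
errors, satisfies a system of linear recursive inequalities with slow and fast modes. -/
theorem exists_error_recursion (hG : G.Connected) {μ L : ℝ} (hN : 0 < N) (hL0 : 0 ≤ L)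
    (hdiff : ∀ i, Differentiable ℝ (f i))
    (hconv : StrongConvexOn Set.univ μ (fun x => ∑ i, f i x))
    (hL : ∀ i x y, ‖gradient (f i) x - gradient (f i) y‖ ≤ L * ‖x - y‖)
    {xs : Vec n} (hxs : ∑ i, gradient (f i) xs = 0) {ρ : ℝ} (hρ : 0 < ρ) {α : ℝ}
    (hα : α ∈ Set.Ioo (0 : ℝ) 1) (B : ℝ) :
    ∃ (c : State G n → ℝ) (η C : ℝ), η ∈ Set.Ioc (0 : ℝ) 1 ∧ 0 < C ∧ (∀ S, 0 ≤ c S) ∧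
      (∃ K, 0 ≤ K ∧ ∀ S, c S ≤ K * (1 + ∑ j, ‖S.x j‖ + ∑ d, ‖S.z d‖)) ∧
      ∀ δ ∈ Set.Ioo 0 B, ∀ γ ∈ Set.Ioo (0 : ℝ) 1, γ * δ * (N * L ^ 2) ≤ μ → ∀ S,
        ‖mean (step G f ρ α γ δ S).x - xs‖ ≤ (1 - γ * δ * (μ / (2 * N))) * ‖mean S.x - xs‖
            + γ * δ * C * spread S.x + γ * C * c S ∧
        spread (step G f ρ α γ δ S).x ≤ (1 - γ) * spread S.x + γ * C * c S ∧
        c (step G f ρ α γ δ S) ≤ (1 - η) * c S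
            + γ * C * (spread S.x + δ * ‖mean S.x - xs‖ + c S) := by
  obtain ⟨e, η, C, hη, hC, he0, hinit, hout, hstep⟩ :=
    exists_tracking_error (G := G) (E := Vec n) hG hρ hα
  have hN1 : (1 : ℝ) ≤ N := by exact_mod_cast hN
  set e₁ : State G n → ℝ := fun S => e S.x (fun d => (S.z d).1) with he₁
  set e₂ : State G n → ℝ := fun S => e (localGradient f S) (fun d => (S.z d).2) with he₂
  -- A nonnegative bound for `δ`, whatever the sign of `B`. `D` bounds the perturbation by the
  -- tracking error, and `C'` dominates all coupling coefficients.
  set B' : ℝ := max B 0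
  have hB' : 0 ≤ B' := le_max_right _ _
  set D : ℝ := C * (1 + B') with hD
  have hD0 : 0 < D := by positivity
  set C' : ℝ := 1 + L + 2 * N * D + C * (1 + L) * (1 + B' * L + L * N + N * D) with hC'
  have hC'1 : L ≤ C' := by
    have : 0 ≤ 2 * N * D + C * (1 + L) * (1 + B' * L + L * N + N * D) := by positivity
    linarith
  have hC'2 : 2 * N * D ≤ C' := by
    have : 0 ≤ 1 + L + C * (1 + L) * (1 + B' * L + L * N + N * D) := by positivity
    linarith
  have hC'3 : C * (1 + L) * (1 + B' * L + L * N + N * D) ≤ C' := by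
    have : 0 ≤ 1 + L + 2 * N * D := by positivity
    linarith
  have hDC : D ≤ C' := by nlinarith
  refine ⟨fun S => e₁ S + e₂ S, η, C', hη, by positivity, fun S => add_nonneg (he0 _ _) (he0 _ _),
    ?_, ?_⟩
  · set K₀ : ℝ := ∑ i, ‖gradient (f i) 0‖
    have hK₀ : 0 ≤ K₀ := Finset.sum_nonneg fun _ _ => norm_nonneg _
    refine ⟨C * (2 + L + K₀), by positivity, fun S => ?_⟩
    have h1 := hinit S.x (fun d => (S.z d).1)
    have h2 := hinit (localGradient f S) (fun d => (S.z d).2)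
    have h3 := sum_norm_localGradient_le hL S
    have h4 : ∑ d, ‖(S.z d).1‖ ≤ ∑ d, ‖S.z d‖ := Finset.sum_le_sum fun d _ => norm_fst_le _
    have h5 : ∑ d, ‖(S.z d).2‖ ≤ ∑ d, ‖S.z d‖ := Finset.sum_le_sum fun d _ => norm_snd_le _
    have hX : 0 ≤ ∑ j, ‖S.x j‖ := Finset.sum_nonneg fun _ _ => norm_nonneg _
    have hZ : 0 ≤ ∑ d, ‖S.z d‖ := Finset.sum_nonneg fun _ _ => norm_nonneg _
    calc e₁ S + e₂ S ≤ C * (∑ j, ‖S.x j‖ + ∑ d, ‖S.z d‖)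
          + C * (L * ∑ i, ‖S.x i‖ + K₀ + ∑ d, ‖S.z d‖) := by
          refine add_le_add (h1.trans ?_) (h2.trans ?_) <;> gcongr
      _ = C * ((1 + L) * ∑ j, ‖S.x j‖ + 2 * ∑ d, ‖S.z d‖ + K₀) := by ring
      _ ≤ C * ((2 + L + K₀) * (1 + ∑ j, ‖S.x j‖ + ∑ d, ‖S.z d‖)) := by
          gcongr
          have := mul_nonneg hK₀ hX
          have := mul_nonneg hK₀ hZ
          have := mul_nonneg hL0 hZ
          linarith
      _ = _ := by ring
  · rintro δ ⟨hδ, hδB⟩ γ hγ hsmall S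
    have hδB' : δ ≤ B' := hδB.le.trans (le_max_left _ _)
    have hγ0 := hγ.1.le
    have hs : 0 ≤ γ * δ := mul_nonneg hγ0 hδ.le
    set S' := step G f ρ α γ δ S with hS'
    have he₁0 : 0 ≤ e₁ S := he0 _ _
    have he₂0 : 0 ≤ e₂ S := he0 _ _
    set r : Fin N → Vec n := fun i => (mixed G ρ S.x (fun d => (S.z d).1) i - mean S.x)
        - δ • (mixed G ρ (localGradient f S) (fun d => (S.z d).2) i - mean (localGradient f S))
    have hr : ∀ i, ‖r i‖ ≤ D * (e₁ S + e₂ S) := by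
      intro i
      calc ‖r i‖ ≤ C * e₁ S + δ * (C * e₂ S) := by
            refine (norm_sub_le _ _).trans (add_le_add (hout _ _ i) ?_)
            rw [norm_smul, Real.norm_of_nonneg hδ.le]
            gcongr
            exact hout _ _ i
        _ ≤ C * e₁ S + B' * (C * e₂ S) := by gcongr
        _ ≤ D * (e₁ S + e₂ S) := by
            have := mul_nonneg (mul_nonneg hC.le hB') he₁0
            have := mul_nonneg hC.le he₂0
            rw [hD]
            linarith
    have hx' : ∀ i, S'.x i = S.x i + γ • (mean S.x - S.x i)
        - (γ * δ) • mean (fun i => gradient (f i) (S.x i)) + γ • r i :=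
      step_x_eq f ρ α γ δ S
    have hb0 := spread_nonneg S.x
    have ha0 := norm_nonneg (mean S.x - xs)
    have hc0 : 0 ≤ e₁ S + e₂ S := add_nonneg he₁0 he₂0
    refine ⟨?_, ?_, ?_⟩
    · refine (error_step hN hγ0 hs hL hx' hr (norm_mean_gradient_step_le hN hdiff hconv hL hxs hs
        hsmall _)).trans ?_
      rw [mul_assoc (γ * δ) C', mul_assoc γ C']
      gcongr
    · refine (spread_step hN hγ hx' hr).trans ?_
      rw [mul_assoc γ C', ← mul_assoc (2 * (N : ℝ))]
      gcongr
    · set Δ := ∑ i, ‖S'.x i - S.x i‖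
      -- The mean gradient vanishes at `xs`, so the optimality error enters only through the descent
      -- term and keeps its factor `γδ`.
      have hΔ : Δ ≤ γ * ((1 + B' * L + L * N + N * D)
          * (spread S.x + δ * ‖mean S.x - xs‖ + (e₁ S + e₂ S))) := by
        have hmz : mean (fun i => gradient (f i) xs) = 0 := by rw [mean, hxs, smul_zero]
        have h1 := card_mul_norm_mean_gradient_le (x := S.x) hN hL0 hL hmz
        have h2 := mul_le_mul_of_nonneg_left h1 hs
        have h3 := variation_step hγ0 hs hx' hr
        have h4 : δ * (L * spread S.x) ≤ B' * (L * spread S.x) := by gcongr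
        calc Δ ≤ γ * (spread S.x + δ * (L * spread S.x) + L * N * (δ * ‖mean S.x - xs‖)
              + N * D * (e₁ S + e₂ S)) := by linarith
          _ ≤ γ * (spread S.x + B' * (L * spread S.x) + L * N * (δ * ‖mean S.x - xs‖)
              + N * D * (e₁ S + e₂ S)) := by gcongr
          _ ≤ _ := by
              gcongr
              have k1 : 0 ≤ L * N * (spread S.x + (e₁ S + e₂ S)) := by positivity
              have k2 : 0 ≤ N * D * (spread S.x + δ * ‖mean S.x - xs‖) := by positivity
              have k3 : 0 ≤ (1 + B' * L) * (δ * ‖mean S.x - xs‖ + (e₁ S + e₂ S)) := by positivity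
              linarith
      have h1 : e₁ S' ≤ (1 - η) * e₁ S + C * Δ := by
        have := hstep S.x S'.x (fun d => (S.z d).1)
        rwa [← step_z_fst f ρ α γ δ S] at this
      have h2 : e₂ S' ≤ (1 - η) * e₂ S + C * (L * Δ) := by
        have := hstep (localGradient f S) (localGradient f S') (fun d => (S.z d).2)
        rw [← step_z_snd f ρ α γ δ S] at this
        refine this.trans ?_
        gcongr
        exact sum_norm_localGradient_sub_le hL S S'
      have h3 : C * (1 + L) * Δ ≤ γ * C' * (spread S.x + δ * ‖mean S.x - xs‖ + (e₁ S + e₂ S)) := by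
        calc C * (1 + L) * Δ ≤ C * (1 + L) * (γ * ((1 + B' * L + L * N + N * D)
              * (spread S.x + δ * ‖mean S.x - xs‖ + (e₁ S + e₂ S)))) := by gcongr
          _ = γ * (C * (1 + L) * (1 + B' * L + L * N + N * D))
              * (spread S.x + δ * ‖mean S.x - xs‖ + (e₁ S + e₂ S)) := by ring
          _ ≤ _ := by gcongr
      linarith

end ADMMTracking

/-! ### Lyapunov function and conclusion. -/

theorem theorem2 {N n : ℕ} (G : SimpleGraph (Fin N)) [DecidableRel G.Adj]
    (hG : G.Connected)
    (f : Fin N → EuclideanSpace ℝ (Fin n) → ℝ)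
    (μ : ℝ) (hμ : 0 < μ) (L : NNReal)
    (hdiff : ∀ i, Differentiable ℝ (f i))
    (hconv : StrongConvexOn Set.univ μ (fun x => ∑ i, f i x))
    (hlip : ∀ i, LipschitzWith L (gradient (f i))) :
    ∃ xstar : EuclideanSpace ℝ (Fin n),
      (∀ x, x ≠ xstar → ∑ i, f i xstar < ∑ i, f i x) ∧
      ∀ ρ : ℝ, 0 < ρ → ∀ α : ℝ, α ∈ Set.Ioo (0 : ℝ) 1 →
        ∃ γbar : ℝ, 0 < γbar ∧
          ∀ δ : ℝ, δ ∈ Set.Ioo (0 : ℝ) (2 * μ / ((N : ℝ) * (L : ℝ) ^ 2)) →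
            ∃ κ : ℝ, 0 < κ ∧
              ∀ γ : ℝ, γ ∈ Set.Ioo (0 : ℝ) γbar →
                ∃ c₂ : ℝ, 0 < c₂ ∧
                  ∀ (S₀ : ADMMTracking.State G n) (i : Fin N) (t : ℕ),
                    ‖(ADMMTracking.iterate G f ρ α γ δ S₀ t).x i - xstar‖
                      ≤ κ * (1 + ∑ j, ‖S₀.x j‖ + ∑ d, ‖S₀.z d‖) * Real.exp (-c₂ * (t : ℝ)) := by
  have hN : 0 < N := by
    obtain ⟨i⟩ := hG.nonempty
    exact i.pos
  have hN' : (0 : ℝ) < N := Nat.cast_pos.2 hN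
  have hL : ∀ i x y, ‖gradient (f i) x - gradient (f i) y‖ ≤ L * ‖x - y‖ := fun i x y => by
    simpa only [dist_eq_norm] using (hlip i).dist_le_mul x y
  obtain ⟨xs, hxs⟩ := hconv.exists_gradient_eq_zero hμ (ADMMTracking.hasGradientAt_sum hdiff)
    (ADMMTracking.norm_sum_gradient_sub_le hL)
  refine ⟨xs, fun x hx =>
    hconv.lt_of_gradient_eq_zero hμ (ADMMTracking.hasGradientAt_sum hdiff) hxs hx, ?_⟩
  intro ρ hρ α hα
  -- If `L = 0`, division by zero gives `B = 0` and the range of `δ` is empty.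
  set B : ℝ := 2 * μ / ((N : ℝ) * (L : ℝ) ^ 2) with hB
  obtain ⟨c, η, C, hη, hC, hc0, ⟨K, hK0, hK⟩, hrec⟩ := ADMMTracking.exists_error_recursion hG hN
    L.coe_nonneg hdiff hconv hL hxs hρ hα B
  obtain ⟨p, q, γbar, hp, hq, hγbar, hw⟩ := exists_weighted_contraction (m := μ / (2 * N))
    (by positivity) hC (by positivity : 0 ≤ B) hη
  refine ⟨γbar, hγbar.1, fun δ hδ => ?_⟩
  have hδL : δ * (N * (L : ℝ) ^ 2) ≤ 2 * μ := by
    rcases (by positivity : 0 ≤ (N : ℝ) * (L : ℝ) ^ 2).eq_or_lt with h | h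
    · rw [← h, mul_zero]
      positivity
    · exact ((lt_div_iff₀ h).1 hδ.2).le
  -- The terms bound the initial optimality error, spread and tracking error relative to `W`; `p`,
  -- `q` and `K` are fixed before `γ`.
  refine ⟨1 + ‖xs‖ + p * 2 + q * K, by positivity, fun γ hγ => ?_⟩
  have hγ2 : γ < 1 / 2 := hγ.2.trans_le hγbar.2
  -- The bound `γ < 1 / 2` is what lets `δ` range up to `2μ / (N L²)`.
  have hsmall : γ * δ * (N * (L : ℝ) ^ 2) ≤ μ := by
    rw [mul_assoc]
    calc γ * (δ * (N * (L : ℝ) ^ 2)) ≤ 1 / 2 * (2 * μ) := by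
          have := hγ.1
          have := hδ.1
          gcongr
      _ = μ := by ring
  obtain ⟨ε, hε, hcontr⟩ := hw δ hδ γ hγ
  refine ⟨ε, hε.1, fun S₀ i t => ?_⟩
  set V : ADMMTracking.State G n → ℝ := fun S => ‖mean S.x - xs‖ + p * spread S.x + q * c S with hV
  have hstep : ∀ S, V (ADMMTracking.step G f ρ α γ δ S) ≤ (1 - ε) * V S := fun S => by
    obtain ⟨h1, h2, h3⟩ := hrec δ hδ γ ⟨hγ.1, by linarith⟩ hsmall S
    exact hcontr _ _ _ _ _ _ (norm_nonneg _) (spread_nonneg _) (hc0 S) h1 h2 h3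
  have hε' : 0 ≤ 1 - ε := by linarith [hε.2]
  have hVt : ∀ t, V (ADMMTracking.iterate G f ρ α γ δ S₀ t) ≤ (1 - ε) ^ t * V S₀ := by
    intro t
    induction t with
    | zero => simp [ADMMTracking.iterate]
    | succ t ih =>
      rw [ADMMTracking.iterate, Function.iterate_succ_apply', pow_succ', mul_assoc]
      exact (hstep _).trans (mul_le_mul_of_nonneg_left ih hε')
  have hX : 0 ≤ ∑ j, ‖S₀.x j‖ := Finset.sum_nonneg fun _ _ => norm_nonneg _
  have hZ : 0 ≤ ∑ d, ‖S₀.z d‖ := Finset.sum_nonneg fun _ _ => norm_nonneg _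
  set W : ℝ := 1 + ∑ j, ‖S₀.x j‖ + ∑ d, ‖S₀.z d‖ with hW
  have hV0 : V S₀ ≤ (1 + ‖xs‖ + p * 2 + q * K) * W := by
    have h1 : ‖mean S₀.x - xs‖ ≤ (1 + ‖xs‖) * W := by
      have a1 := norm_sub_le (mean S₀.x) xs
      have a2 := norm_mean_le_sum hN S₀.x
      have a3 : ‖xs‖ * 1 ≤ ‖xs‖ * W := by gcongr; linarith
      linarith
    have h2 : p * spread S₀.x ≤ p * (2 * W) := by
      have := spread_le hN S₀.x
      gcongr
      linarith
    have h3 : q * c S₀ ≤ q * (K * W) := by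
      gcongr
      exact hK S₀
    linarith
  set S := ADMMTracking.iterate G f ρ α γ δ S₀ t
  -- The weight `p ≥ 1` lets `V` dominate the distance of each individual estimate.
  have hx : ‖S.x i - xs‖ ≤ V S := by
    have h1 : ‖S.x i - xs‖ ≤ ‖S.x i - mean S.x‖ + ‖mean S.x - xs‖ := by
      rw [← sub_add_sub_cancel (S.x i) (mean S.x) xs]
      exact norm_add_le _ _
    have h2 := norm_sub_le_spread S.x i
    have h3 := mul_le_mul_of_nonneg_right hp (spread_nonneg S.x)
    have h4 := mul_nonneg hq.le (hc0 S)
    simp only [hV]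
    linarith
  have hexp : (1 - ε) ^ t ≤ Real.exp (-ε * t) := by
    rw [mul_comm, Real.exp_nat_mul]
    gcongr
    linarith [Real.add_one_le_exp (-ε)]
  calc ‖S.x i - xs‖ ≤ (1 - ε) ^ t * V S₀ := hx.trans (hVt t)
    _ ≤ Real.exp (-ε * t) * ((1 + ‖xs‖ + p * 2 + q * K) * W) := by
        have : 0 ≤ V S₀ := by
          have h2 := mul_nonneg (zero_le_one.trans hp) (spread_nonneg S₀.x)
          have h4 := mul_nonneg hq.le (hc0 S₀)
          have h5 := norm_nonneg (mean S₀.x - xs)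
          simp only [hV]
          linarith
        gcongr
    _ = _ := mul_comm _ _
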